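/- Let $F$ be a field of characteristic $p>0$ with $p\neq 2$, and let $n\geq 3$ be an integer. Let $A(n)=F[x_1,\dots,x_n]/(x_1^p,\dots,x_n^p)$ and let $W(n)=\mathrm{Der}_F A(n)$, which is a free $A(n)$-module with basis $D_1,\dots,D_n$, where $D_i=\partial/\partial x_i$. Let $\mathrm{div}:W(n)\to A(n)$ be the divergence $\mathrm{div}\left(\sum_{i=1}^n f_iD_i\right)=\sum_{i=1}^n D_i(f_i)$, let $S'(n)=\{E\in W(n) : \mathrm{div}(E)=0\}$, and let $S(n)=[S'(n),S'(n)]$ be its derived algebra (the special algebra). Write $\tau=(p-1,\dots,p-1)\in\mathbb{Z}^n$, let $\epsilon_i$ be the $i$-th standard basis vector of $\mathbb{Z}^n$, and put $x^a=x_1^{a_1}\cdots x_n^{a_n}$. Each of the elements $x^{\tau-(p-1)\epsilon_i}D_i$ ($i=1,\dots,n$) and $x_1D_1$ of $W(n)$ normalizes $S(n)$, so that its adjoint action $\mathrm{ad}(E)=[E,\cdot\,]$ restricts to a derivation of $S(n)$, that is, to a $1$-cocycle of $S(n)$ with values in the adjoint module. The classes of these $n+1$ derivations form a basis of the first Lie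 algebra cohomology group of $S(n)$ with values in the adjoint module: $$H^1(S(n),S(n))=\bigoplus_{i=1}^n F\cdot\langle \mathrm{ad}(x^{\tau-(p-1)\epsilon_i}D_i)\rangle\ \oplus\ F\cdot\langle \mathrm{ad}(x_1D_1)\rangle .$$ -/

import Mathlib

/-! ## First Chevalley-Eilenberg cohomology -/

section Cohomology

variable (R : Type*) [CommRing R]
variable (L : Type*) [LieRing L] [LieAlgebra R L]
variable (M : Type*) [AddCommGroup M] [Module R M] [LieRingModule L M] [LieModule R L M]

/-- The differential from 0-cochains (elements of `M`) to 1-cochains: `m ↦ (x ↦ x · m)`. -/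
def lieD₀₁ : M →ₗ[R] LieModule.Cohomology.oneCochain R L M :=
  (LieModule.toEnd R L M : L →ₗ[R] Module.End R M).flip

/-- The 1-cocycles `Z¹(L, M)`. -/
abbrev LieZ1 : Submodule R (LieModule.Cohomology.oneCochain R L M) :=
  LinearMap.ker (LieModule.Cohomology.d₁₂ R L M)

/-- The 1-coboundaries `B¹(L, M)`. -/
abbrev LieB1 : Submodule R (LieModule.Cohomology.oneCochain R L M) :=
  LinearMap.range (lieD₀₁ R L M)

/-- Coboundaries are cocycles. -/
theorem lieB1_le_lieZ1 : LieB1 R L M ≤ LieZ1 R L M := by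
  rintro _ ⟨m, rfl⟩
  rw [LinearMap.mem_ker]
  ext x y
  simp [lieD₀₁]

/-- The first cohomology group `H¹(L, M) = Z¹(L, M) / B¹(L, M)`. -/
abbrev LieH1 : Type _ :=
  LieZ1 R L M ⧸ (LieB1 R L M).submoduleOf (LieZ1 R L M)

end Cohomology

section AdRestrict

variable {R : Type*} [CommRing R] {L : Type*} [LieRing L] [LieAlgebra R L]

/-- If `E` normalizes the subalgebra `K`, then `ad E` restricts to a derivation of `K`, that is,
to a 1-cocycle of `K` with values in the adjoint module. -/
def adCocycle (K : LieSubalgebra R L) (E : L) (hE : E ∈ K.normalizer) : LieZ1 R K K :=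
  ⟨{ toFun := fun y => ⟨⁅E, (y : L)⁆, (K.mem_normalizer_iff E).1 hE y y.2⟩
     map_add' := fun y z => by ext; simp
     map_smul' := fun c y => by ext; simp },
   by
    rw [LinearMap.mem_ker]
    ext x y
    change ⁅(x : L), ⁅E, (y : L)⁆⁆ - ⁅(y : L), ⁅E, (x : L)⁆⁆ - ⁅E, ⁅(x : L), (y : L)⁆⁆ = 0
    rw [leibniz_lie E, ← lie_skew ⁅E, (x : L)⁆ (y : L)]
    abel⟩

/-- The class of `ad E` in `H¹(K, K)`. -/
def adClass (K : LieSubalgebra R L) (E : L) (hE : E ∈ K.normalizer) : LieH1 R K K :=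
  Submodule.Quotient.mk (adCocycle K E hE)

/-- The derived algebra `[K, K]` of a subalgebra `K`, as a subalgebra of the ambient algebra. -/
def derivedSubalgebra (K : LieSubalgebra R L) : LieSubalgebra R L :=
  ((LieAlgebra.derivedSeries R K 1).toLieSubalgebra R K).map K.incl

theorem mem_derivedSubalgebra_iff (K : LieSubalgebra R L) (E : L) : E ∈ derivedSubalgebra K ↔
    E ∈ Submodule.span R {G | ∃ E₁ ∈ K, ∃ E₂ ∈ K, ⁅E₁, E₂⁆ = G} := by
  have h := congrArg (Submodule.map (K.incl : K →ₗ[R] L))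
    (LieAlgebra.coe_derivedSeries_one_eq R K)
  have h2 : {G | ∃ E₁ ∈ K, ∃ E₂ ∈ K, ⁅E₁, E₂⁆ = G} =
      (K.incl : K →ₗ[R] L) '' {⁅a, b⁆ | (a : K) (b : K)} := by
    ext G
    constructor
    · rintro ⟨a, ha, b, hb, rfl⟩
      exact ⟨_, ⟨⟨a, ha⟩, ⟨b, hb⟩, rfl⟩, rfl⟩
    · rintro ⟨_, ⟨a, b, rfl⟩, rfl⟩
      exact ⟨a, a.2, b, b.2, rfl⟩
  rw [Submodule.map_span, ← h2] at h
  rw [← h]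
  rfl

/-- An element normalizing `K` normalizes `[K, K]`. -/
theorem normalizer_le_normalizer_derivedSubalgebra (K : LieSubalgebra R L) :
    K.normalizer ≤ (derivedSubalgebra K).normalizer := by
  intro E hE
  rw [LieSubalgebra.mem_normalizer_iff] at hE ⊢
  intro G hG
  rw [mem_derivedSubalgebra_iff] at hG ⊢
  induction hG using Submodule.span_induction with
  | mem G h =>
    obtain ⟨a, ha, b, hb, rfl⟩ := h
    rw [leibniz_lie]
    exact add_mem (Submodule.subset_span ⟨_, hE a ha, b, hb, rfl⟩)
      (Submodule.subset_span ⟨a, ha, _, hE b hb, rfl⟩)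
  | zero => simp
  | add G G' _ _ h h' => rw [lie_add]; exact add_mem h h'
  | smul c G _ h => rw [lie_smul]; exact Submodule.smul_mem _ _ h

end AdRestrict

/-! ## The algebras `A(n)`, `W(n)`, `S'(n)`, `S(n)` -/

namespace SpecialAlgebra

noncomputable section

variable (F : Type*) [Field F] (p n : ℕ)

/-- The ideal `(x_1^p, ..., x_n^p)`. -/
def truncIdeal : Ideal (MvPolynomial (Fin n) F) :=
  Ideal.span (Set.range fun i : Fin n => (MvPolynomial.X i : MvPolynomial (Fin n) F) ^ p)

/-- `A(n) = F[x_1, ..., x_n] / (x_1^p, ..., x_n^p)`. -/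
abbrev A : Type _ := MvPolynomial (Fin n) F ⧸ truncIdeal F p n

/-- `W(n) = Der_F A(n)`. -/
abbrev W : Type _ := Derivation F (A F p n) (A F p n)

variable {n}

/-- The generator `x_i` of `A(n)`. -/
def x (i : Fin n) : A F p n := Ideal.Quotient.mk (truncIdeal F p n) (MvPolynomial.X i)

/-- The monomial `x^a = x_1^{a_1} ⋯ x_n^{a_n}` of `A(n)`. -/
def xpow (a : Fin n → ℕ) : A F p n := ∏ j, x F p j ^ a j

theorem sum_W_apply (g : Fin n → W F p n) (a : A F p n) : (∑ i, g i) a = ∑ i, g i a :=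
  map_sum (⟨⟨fun E : W F p n => E a, rfl⟩, fun _ _ => rfl⟩ : W F p n →+ A F p n) g Finset.univ

theorem W_ext {E E' : W F p n} (h : ∀ i, E (x F p i) = E' (x F p i)) : E = E' := by
  have key : ∀ f : MvPolynomial (Fin n) F,
      E (Ideal.Quotient.mk (truncIdeal F p n) f) = E' (Ideal.Quotient.mk (truncIdeal F p n) f) := by
    intro f
    induction f using MvPolynomial.induction_on with
    | C a =>
      have : Ideal.Quotient.mk (truncIdeal F p n) (MvPolynomial.C a) =
        algebraMap F (A F p n) a := rfl
      rw [this, E.map_algebraMap, E'.map_algebraMap]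
    | add f g hf hg => rw [map_add, map_add, map_add, hf, hg]
    | mul_X f i hf =>
      have := h i
      rw [x] at this
      rw [map_mul, Derivation.leibniz, Derivation.leibniz, hf, this]
  ext a
  obtain ⟨f, rfl⟩ := Ideal.Quotient.mk_surjective a
  exact key f

variable [CharP F p]

theorem pderiv_mem (i : Fin n) (f : MvPolynomial (Fin n) F) (hf : f ∈ truncIdeal F p n) :
    MvPolynomial.pderiv i f ∈ truncIdeal F p n := by
  unfold truncIdeal at hf ⊢
  induction hf using Submodule.span_induction with
  | mem f h =>
    obtain ⟨j, rfl⟩ := h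
    simp [Derivation.leibniz_pow]
  | zero => simp
  | add f g _ _ hf hg => simpa using add_mem hf hg
  | smul a f h hf =>
    rw [smul_eq_mul, Derivation.leibniz]
    exact add_mem (Ideal.mul_mem_left _ _ hf) (by
      rw [smul_eq_mul]; exact Ideal.mul_mem_right _ _ h)

theorem mk_pderiv_eq_zero (i : Fin n) (f : MvPolynomial (Fin n) F)
    (hf : Ideal.Quotient.mkₐ F (truncIdeal F p n) f = 0) :
    Ideal.Quotient.mkₐ F (truncIdeal F p n) (MvPolynomial.pderiv i f) = 0 := by
  simp only [Ideal.Quotient.mkₐ_eq_mk, Ideal.Quotient.eq_zero_iff_mem] at hf ⊢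
  exact pderiv_mem F p i f hf

/-- The partial derivative `D_i = ∂/∂x_i` on `A(n)`. -/
def D (i : Fin n) : W F p n :=
  Derivation.liftOfSurjective (f := Ideal.Quotient.mkₐ F (truncIdeal F p n))
    (Ideal.Quotient.mkₐ_surjective F _) (mk_pderiv_eq_zero F p i)

theorem D_mk (i : Fin n) (f : MvPolynomial (Fin n) F) :
    D F p i (Ideal.Quotient.mk (truncIdeal F p n) f) =
      Ideal.Quotient.mk (truncIdeal F p n) (MvPolynomial.pderiv i f) :=
  Derivation.liftOfSurjective_apply (f := Ideal.Quotient.mkₐ F (truncIdeal F p n))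
    (Ideal.Quotient.mkₐ_surjective F _) (mk_pderiv_eq_zero F p i) f

theorem D_x (i j : Fin n) : D F p i (x F p j) = if j = i then 1 else 0 := by
  classical
  rw [x, D_mk, MvPolynomial.pderiv_X, Pi.single_apply]
  split_ifs <;> simp

/-- `W(n)` is spanned over `A(n)` by the `D_i`: the coefficients of `E` are `f_i = E(x_i)`. -/
theorem W_eq_sum (E : W F p n) : E = ∑ i, E (x F p i) • D F p i := by
  apply W_ext
  intro j
  simp [sum_W_apply, D_x]

theorem W_apply (E : W F p n) (a : A F p n) : E a = ∑ i, E (x F p i) * D F p i a := by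
  conv_lhs => rw [W_eq_sum F p E]
  simp [sum_W_apply]

theorem D_comm (i j : Fin n) (a : A F p n) : D F p i (D F p j a) = D F p j (D F p i a) := by
  have : ⁅D F p i, D F p j⁆ = 0 := by
    apply W_ext
    intro k
    rw [Derivation.commutator_apply, D_x, D_x]
    split_ifs <;> simp
  rw [← sub_eq_zero, ← Derivation.commutator_apply, this, Derivation.zero_apply]

/-- The divergence `∑ f_i D_i ↦ ∑ D_i(f_i)`; the coefficient `f_i` of `E` is `E(x_i)`. -/
def div : W F p n →ₗ[F] A F p n where
  toFun E := ∑ i, D F p i (E (x F p i))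
  map_add' E E' := by simp [Finset.sum_add_distrib]
  map_smul' c E := by simp [Finset.smul_sum]

theorem div_apply (E : W F p n) : div F p E = ∑ i, D F p i (E (x F p i)) := rfl

theorem div_smul_D (f : A F p n) (i : Fin n) : div F p (f • D F p i) = D F p i f := by
  rw [div_apply, Finset.sum_eq_single i]
  · simp [D_x]
  · intro j _ hj
    simp [D_x, hj]
  · simp

theorem div_sum (f : Fin n → A F p n) : div F p (∑ i, f i • D F p i) = ∑ i, D F p i (f i) := by
  rw [map_sum]
  exact Finset.sum_congr rfl fun i _ => div_smul_D F p (f i) i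

theorem div_lie (E E' : W F p n) : div F p ⁅E, E'⁆ = E (div F p E') - E' (div F p E) := by
  have key : ∀ G G' : W F p n, ∑ i, D F p i (G (G' (x F p i))) =
      G (div F p G') +
        ∑ i, ∑ j, D F p i (G (x F p j)) * D F p j (G' (x F p i)) := by
    intro G G'
    rw [div_apply, map_sum, ← Finset.sum_add_distrib]
    refine Finset.sum_congr rfl fun i _ => ?_
    rw [W_apply F p G (G' _), W_apply F p G (D F p i _), map_sum, ← Finset.sum_add_distrib]
    refine Finset.sum_congr rfl fun j _ => ?_
    rw [Derivation.leibniz, D_comm F p i j, smul_eq_mul, smul_eq_mul]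
    ring
  have hs : ∑ i, ∑ j, D F p i (E (x F p j)) * D F p j (E' (x F p i)) =
      ∑ i, ∑ j, D F p i (E' (x F p j)) * D F p j (E (x F p i)) := by
    rw [Finset.sum_comm]
    exact Finset.sum_congr rfl fun i _ => Finset.sum_congr rfl fun j _ => mul_comm _ _
  rw [div_apply]
  simp only [Derivation.commutator_apply, map_sub, Finset.sum_sub_distrib]
  rw [key, key, hs]
  ring

variable (n)

/-- `S'(n)`, the divergence-free derivations. -/
def SPrime : LieSubalgebra F (W F p n) where
  __ := LinearMap.ker (div F p (n := n))
  lie_mem' := by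
    intro E E' hE hE'
    have hE : div F p E = 0 := hE
    have hE' : div F p E' = 0 := hE'
    change div F p ⁅E, E'⁆ = 0
    rw [div_lie, hE, hE', map_zero, map_zero, sub_zero]

/-- The special algebra `S(n) = [S'(n), S'(n)]`, as a subalgebra of `W(n)`. -/
def S : LieSubalgebra F (W F p n) := derivedSubalgebra (SPrime F p n)

variable {n}

theorem mem_SPrime (E : W F p n) : E ∈ SPrime F p n ↔ div F p E = 0 := Iff.rfl

/-- `x^{τ - (p-1)ε_i} D_i`, where `τ = (p-1, ..., p-1)`. -/
def outer (i : Fin n) : W F p n :=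
  xpow F p ((fun _ => p - 1) - (p - 1) • Pi.single i 1) • D F p i

/-- `x_i D_i`. -/
def xD (i : Fin n) : W F p n := x F p i • D F p i

theorem outer_mem (i : Fin n) : outer F p i ∈ (S F p n).normalizer := by
  apply normalizer_le_normalizer_derivedSubalgebra
  apply LieSubalgebra.le_normalizer
  rw [mem_SPrime, outer, div_smul_D, xpow]
  have : ∀ s : Finset (Fin n), D F p i (∏ j ∈ s,
      x F p j ^ ((fun _ => p - 1) - (p - 1) • Pi.single i 1 : Fin n → ℕ) j) = 0 := by
    intro s
    induction s using Finset.induction_on with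
    | empty => simp
    | insert j s hj ih =>
      rw [Finset.prod_insert hj, Derivation.leibniz, ih, smul_zero, zero_add,
        Derivation.leibniz_pow, D_x]
      by_cases hij : j = i
      · subst hij
        simp
      · simp [hij]
  exact this _

theorem xD_mem (i : Fin n) : xD F p i ∈ (S F p n).normalizer := by
  apply normalizer_le_normalizer_derivedSubalgebra
  rw [LieSubalgebra.mem_normalizer_iff]
  intro E hE
  rw [mem_SPrime] at hE ⊢
  rw [div_lie, hE, xD, div_smul_D, D_x]
  simp

end

end SpecialAlgebra

namespace SpecialAlgebra

noncomputable section

variable (F : Type*) [Field F] (p : ℕ) {n : ℕ}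

/-! ### Coefficients and monomials of `A(n)`, with exponents in `ZMod p` -/

/-! The centralizer of S(n) in W(n) is zero, so once every derivation of S(n) is known to be ad(E)
for some E in W(n), E is unique and normalizes S(n), and H¹ is the normalizer of S(n) modulo S(n).

Existence of E (`Frame.exists_eq_lie`) is shown for cocycles φ from S(n) to W(n) by successive inner
corrections. The values φ(D_i) form a closed system; its only obstruction to integration, the terms
with x_i^{p-1}, is killed by the weights of the torus elements x_iD_i - x_jD_j. After that
correction φ takes constant coefficients on the torus, and a constant vector field corrects it to
zero there. Induction on degree (`Frame.eq_zero_on_m`) then kills φ on the x^a D_k in S(n) with a_k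
= 0, and brackets of these span S(n).

For the normalizer, [D_i, E] in S(n) forces div E to be constant, so E lies in S'(n) + F x_1D_1; and
S'(n) is S(n) plus the span of the x^{τ-(p-1)ε_i}D_i (`SPrime_le`). Independence is read off from
the constant term of div and the coefficients of x^{τ-(p-1)ε_i}D_i, which vanish on S(n)
(`cf_top_eq_zero`).

Exponents live in `ZMod p`: wrapping around from p-1 to 0 occurs exactly where the scalar in a
derivative formula vanishes. -/

theorem mem_truncIdeal_iff (f : MvPolynomial (Fin n) F) :
    f ∈ truncIdeal F p n ↔ ∀ m ∈ f.support, ∃ i, p ≤ m i := by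
  have h : (Set.range fun i : Fin n => (MvPolynomial.X i : MvPolynomial (Fin n) F) ^ p) =
      (fun s => MvPolynomial.monomial s (1 : F)) ''
        Set.range (fun i : Fin n => Finsupp.single i p) := by
    rw [← Set.range_comp]
    congr 1
    funext i
    simp [MvPolynomial.X_pow_eq_monomial]
  rw [truncIdeal, h, MvPolynomial.mem_ideal_span_monomial_image]
  simp

theorem coeff_eq_zero_of_mem_truncIdeal {f : MvPolynomial (Fin n) F} (hf : f ∈ truncIdeal F p n)
    {m : Fin n →₀ ℕ} (hm : ∀ i, m i < p) : f.coeff m = 0 := by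
  by_contra h
  obtain ⟨i, hi⟩ := (mem_truncIdeal_iff F p f).1 hf m (MvPolynomial.mem_support_iff.2 h)
  exact absurd (hm i) (not_lt.2 hi)

/-- The exponent vector with entries `(a i).val`. -/
def expo (a : Fin n → ZMod p) : Fin n →₀ ℕ := Finsupp.equivFunOnFinite.symm fun i => (a i).val

@[simp]
theorem expo_apply (a : Fin n → ZMod p) (i : Fin n) : expo p a i = (a i).val := rfl

theorem expo_injective [NeZero p] : Function.Injective (expo p : (Fin n → ZMod p) → _) := by
  intro a b h
  funext i
  exact ZMod.val_injective p (by simpa using DFunLike.congr_fun h i)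

/-- The monomial `x^a` for a vector `a` of residues modulo `p`. -/
def mon (a : Fin n → ZMod p) : A F p n := xpow F p fun i => (a i).val

theorem mon_eq_mk (a : Fin n → ZMod p) :
    mon F p a = Ideal.Quotient.mk (truncIdeal F p n) (MvPolynomial.monomial (expo p a) 1) := by
  rw [MvPolynomial.monomial_eq, Finsupp.prod_fintype _ _ (by simp)]
  simp [mon, xpow, x]

theorem mon_mul_mon {a b c : Fin n → ZMod p} (h : ∀ i, (a i).val + (b i).val = (c i).val) :
    mon F p a * mon F p b = mon F p c := by
  simp only [mon, xpow, ← Finset.prod_mul_distrib, ← pow_add, h]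

variable [Fact p.Prime]

theorem coeff_expo_congr {f g : MvPolynomial (Fin n) F} (a : Fin n → ZMod p)
    (h : Ideal.Quotient.mk (truncIdeal F p n) f = Ideal.Quotient.mk (truncIdeal F p n) g) :
    f.coeff (expo p a) = g.coeff (expo p a) := by
  have := coeff_eq_zero_of_mem_truncIdeal F p (Ideal.Quotient.eq.1 h) (m := expo p a)
    fun i => ZMod.val_lt _
  rwa [MvPolynomial.coeff_sub, sub_eq_zero] at this

/-- The coefficient of the monomial with exponent `a` in an element of `A(n)`. -/
def cf (a : Fin n → ZMod p) : A F p n →ₗ[F] F where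
  toFun f := (Function.surjInv Ideal.Quotient.mk_surjective f).coeff (expo p a)
  map_add' f g := by
    rw [← MvPolynomial.coeff_add]
    apply coeff_expo_congr
    simp only [map_add, Function.surjInv_eq]
  map_smul' c f := by
    rw [RingHom.id_apply, ← MvPolynomial.coeff_smul]
    apply coeff_expo_congr
    rw [Function.surjInv_eq Ideal.Quotient.mk_surjective]
    conv_lhs => rw [← Function.surjInv_eq (Ideal.Quotient.mk_surjective
      (I := truncIdeal F p n)) f]
    rfl

theorem cf_mk (a : Fin n → ZMod p) (f : MvPolynomial (Fin n) F) :
    cf F p a (Ideal.Quotient.mk (truncIdeal F p n) f) = f.coeff (expo p a) :=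
  coeff_expo_congr F p a (Function.surjInv_eq _ _)

theorem A_ext {f g : A F p n} (h : ∀ a, cf F p a f = cf F p a g) : f = g := by
  obtain ⟨f, rfl⟩ := Ideal.Quotient.mk_surjective f
  obtain ⟨g, rfl⟩ := Ideal.Quotient.mk_surjective g
  rw [Ideal.Quotient.eq, mem_truncIdeal_iff]
  intro m hm
  by_contra! hlt
  have he : expo p (fun i => (m i : ZMod p)) = m := by
    ext i
    simp [ZMod.val_natCast_of_lt (hlt i)]
  have := h fun i => (m i : ZMod p)
  rw [cf_mk, cf_mk, he] at this
  rw [MvPolynomial.mem_support_iff, MvPolynomial.coeff_sub, this, sub_self] at hm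
  exact hm rfl

theorem cf_mon (a b : Fin n → ZMod p) : cf F p a (mon F p b) = if b = a then 1 else 0 := by
  rw [mon_eq_mk, cf_mk, MvPolynomial.coeff_monomial]
  simp only [(expo_injective p).eq_iff]

theorem cf_sum_mon (c : (Fin n → ZMod p) → F) (a : Fin n → ZMod p) :
    cf F p a (∑ b, c b • mon F p b) = c a := by
  simp [cf_mon]

theorem sum_cf_mon (f : A F p n) : ∑ a, cf F p a f • mon F p a = f :=
  A_ext F p fun a => cf_sum_mon F p _ a

theorem mon_zero : mon F p (0 : Fin n → ZMod p) = 1 := by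
  rw [mon, xpow]
  exact Finset.prod_eq_one fun i _ => by rw [Pi.zero_apply, ZMod.val_zero, pow_zero]

variable [CharP F p]

/-- The inclusion of the prime field. -/
def ι : ZMod p →+* F := ZMod.castHom dvd_rfl F

theorem ι_eq_val (t : ZMod p) : ι F p t = (t.val : F) := by
  conv_lhs => rw [← ZMod.natCast_zmod_val t, map_natCast]

theorem ι_eq_zero {t : ZMod p} : ι F p t = 0 ↔ t = 0 := map_eq_zero _

/-- The index a + ε_i wraps around only when a_i = p-1, and then the factor a_i + 1 is zero; no
boundary case is needed. -/
theorem cf_D (a : Fin n → ZMod p) (i : Fin n) (f : A F p n) :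
    cf F p a (D F p i f) = ι F p (a i + 1) * cf F p (a + Pi.single i 1) f := by
  obtain ⟨f, rfl⟩ := Ideal.Quotient.mk_surjective f
  rw [D_mk, cf_mk, cf_mk, MvPolynomial.coeff_pderiv, mul_comm]
  by_cases h : a i + 1 = 0
  · rw [h, map_zero, zero_mul]
    have : ((expo p a i : ℕ) + 1 : F) = ι F p (a i + 1) := by
      rw [map_add, map_one, ι_eq_val, expo_apply]
    rw [this, h, map_zero, zero_mul]
  · have hv : (a i + 1).val = (a i).val + 1 := by
      have hlt : (a i).val + 1 < p := by
        refine lt_of_le_of_ne (ZMod.val_lt (a i)) fun he => h ?_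
        have h0 := congrArg (Nat.cast : ℕ → ZMod p) he
        simpa using h0
      have h1 : (1 : ZMod p).val = 1 := ZMod.val_one p
      rw [ZMod.val_add_of_lt (by rwa [h1]), h1]
    have he : expo p a + Finsupp.single i 1 = expo p (a + Pi.single i 1) := by
      ext j
      rcases eq_or_ne j i with rfl | hj
      · simp [hv]
      · simp [hj]
    rw [he, map_add, map_one, ι_eq_val, expo_apply]

theorem D_mon (i : Fin n) (a : Fin n → ZMod p) :
    D F p i (mon F p a) = ι F p (a i) • mon F p (a - Pi.single i 1) := by
  apply A_ext
  intro b
  rw [cf_D, map_smul, cf_mon, cf_mon, smul_eq_mul]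
  by_cases h : a = b + Pi.single i 1
  · subst h
    simp
  · rw [if_neg h, if_neg (fun h' => h (by rw [← h']; simp))]
    simp

theorem cf_x_mul_D (a : Fin n → ZMod p) (i : Fin n) (f : A F p n) :
    cf F p a (x F p i * D F p i f) = ι F p (a i) * cf F p a f := by
  obtain ⟨f, rfl⟩ := Ideal.Quotient.mk_surjective f
  rw [D_mk, x, ← map_mul, cf_mk, cf_mk, MvPolynomial.coeff_X_mul', ι_eq_val]
  split_ifs with h
  · have h' : 1 ≤ expo p a i := Nat.one_le_iff_ne_zero.2 (Finsupp.mem_support_iff.1 h)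
    rw [MvPolynomial.coeff_pderiv, tsub_add_cancel_of_le (Finsupp.single_le_iff.2 h'), mul_comm]
    congr 1
    rw [Finsupp.tsub_apply, Finsupp.single_eq_same, ← Nat.cast_add_one, Nat.sub_add_cancel h']
    rfl
  · rw [Finsupp.notMem_support_iff, expo_apply] at h
    simp [h]

/-- An element all of whose partial derivatives vanish has only a constant term. -/
theorem cf_eq_zero_of_D_eq_zero {f : A F p n} (h : ∀ i, D F p i f = 0) {a : Fin n → ZMod p}
    (ha : a ≠ 0) : cf F p a f = 0 := by
  obtain ⟨i, hi⟩ := Function.ne_iff.1 ha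
  have := cf_D F p (a - Pi.single i 1) i f
  rw [h i, map_zero] at this
  simpa [ι_eq_zero, show a i ≠ 0 from hi] using this

theorem eq_algebraMap_of_D_eq_zero {f : A F p n} (h : ∀ i, D F p i f = 0) :
    f = algebraMap F _ (cf F p 0 f) := by
  apply A_ext
  intro a
  rw [Algebra.algebraMap_eq_smul_one, ← mon_zero, map_smul, cf_mon]
  split_ifs with h0
  · simp [← h0]
  · rw [cf_eq_zero_of_D_eq_zero F p h (Ne.symm h0), smul_zero]

/-- Closed `1`-forms without terms `x_i^{p-1} dx_i` are exact, in terms of coefficients. -/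
theorem exists_primitive (g : Fin n → (Fin n → ZMod p) → F)
    (hg : ∀ i j (a : Fin n → ZMod p), ι F p (a i + 1) * g j (a + Pi.single i 1) =
      ι F p (a j + 1) * g i (a + Pi.single j 1))
    (h0 : ∀ i a, a i = -1 → g i a = 0) :
    ∃ c : (Fin n → ZMod p) → F, ∀ i a, ι F p (a i + 1) * c (a + Pi.single i 1) = g i a := by
  classical
  -- Integrate along any variable that occurs in x^a; closedness makes the result independent of the
  -- choice. The constant term is free and set to 0.
  refine ⟨fun a => if h : ∃ i, a i ≠ 0 then g h.choose (a - Pi.single h.choose 1) /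
    ι F p (a h.choose) else 0, fun i a => ?_⟩
  by_cases hi : a i + 1 = 0
  · rw [hi, map_zero, zero_mul, h0 i a (eq_neg_of_add_eq_zero_left hi)]
  · have hex : ∃ j, (a + Pi.single i 1 : Fin n → ZMod p) j ≠ 0 := ⟨i, by simpa using hi⟩
    simp only [dif_pos hex]
    have hj := hex.choose_spec
    generalize hex.choose = j at hj ⊢
    have hj' : ι F p ((a + Pi.single i 1 : Fin n → ZMod p) j) ≠ 0 :=
      fun h => hj ((ι_eq_zero F p).1 h)
    rw [mul_div_assoc', div_eq_iff hj']
    rcases eq_or_ne i j with rfl | hij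
    · simp [mul_comm]
    · have := hg i j (a - Pi.single j 1)
      simp only [Pi.sub_apply, Pi.add_apply, Pi.single_eq_same, Pi.single_eq_of_ne hij,
        Pi.single_eq_of_ne hij.symm, sub_zero, sub_add_cancel, add_zero] at this ⊢
      rw [mul_comm (g i a), ← this, sub_add_eq_add_sub]

end

end SpecialAlgebra

namespace SpecialAlgebra

noncomputable section

variable (F : Type*) [Field F] (p : ℕ) {n : ℕ} [Fact p.Prime] [CharP F p]

/-! ### The generators `D_{ij}(f)` of `S(n)` -/

omit [CharP F p] in
theorem W_ext_cf {E E' : W F p n} (h : ∀ a k, cf F p a (E (x F p k)) = cf F p a (E' (x F p k))) :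
    E = E' :=
  W_ext F p fun k => A_ext F p fun a => h a k

/-- `D_i(f) D_j - D_j(f) D_i`. -/
def DD (i j : Fin n) : A F p n →ₗ[F] W F p n where
  toFun f := D F p i f • D F p j - D F p j f • D F p i
  map_add' f g := by simp only [map_add, add_smul]; abel
  map_smul' c f := by
    rw [Derivation.map_smul, Derivation.map_smul, smul_assoc c (D F p i f) (D F p j),
      smul_assoc c (D F p j f) (D F p i)]
    exact (smul_sub c (D F p i f • D F p j) (D F p j f • D F p i)).symm

omit [Fact p.Prime] in
theorem DD_apply (i j : Fin n) (f : A F p n) :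
    DD F p i j f = D F p i f • D F p j - D F p j f • D F p i := rfl

omit [Fact p.Prime] in
theorem DD_self (i : Fin n) (f : A F p n) : DD F p i i f = 0 := by
  exact sub_self (D F p i f • D F p i)

omit [Fact p.Prime] in
theorem lie_smul_D_smul_D {k l : Fin n} {f g : A F p n} (hf : D F p k f = 0)
    (hg : D F p l g = 0) : ⁅f • D F p k, g • D F p l⁆ = DD F p k l (f * g) := by
  apply W_ext
  intro m
  simp only [Derivation.commutator_apply, DD_apply, Derivation.sub_apply, Derivation.smul_apply,
    D_x, smul_eq_mul, Derivation.leibniz, hf, hg]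
  split_ifs <;> simp

omit [Fact p.Prime] in
-- With f_i, g_j the coefficients of E, E', the product rule gives ∑ D_i(f_i g) = E(g) when div E =
-- 0, and symmetrically for E'.
theorem lie_eq_sum_DD {E E' : W F p n} (hE : E ∈ SPrime F p n) (hE' : E' ∈ SPrime F p n) :
    ⁅E, E'⁆ = ∑ i, ∑ j, DD F p i j (E (x F p i) * E' (x F p j)) := by
  rw [mem_SPrime, div_apply] at hE hE'
  apply W_ext
  intro m
  simp only [sum_W_apply, DD_apply, Derivation.sub_apply, Derivation.smul_apply, D_x, smul_eq_mul,
    Finset.sum_sub_distrib, mul_ite, mul_one, mul_zero, Finset.sum_ite_eq, Finset.mem_univ,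
    if_true, Derivation.commutator_apply]
  have h1 : ∑ i, D F p i (E (x F p i) * E' (x F p m)) = E (E' (x F p m)) := by
    simp only [Derivation.leibniz, smul_eq_mul, Finset.sum_add_distrib]
    rw [← Finset.mul_sum, hE, mul_zero, add_zero, W_apply F p E]
  have h2 : ∑ j, D F p j (E (x F p m) * E' (x F p j)) = E' (E (x F p m)) := by
    simp only [Derivation.leibniz, smul_eq_mul, Finset.sum_add_distrib]
    rw [← Finset.mul_sum, hE', mul_zero, zero_add, W_apply F p E']
  rw [h1]
  congr 1
  rw [← h2, Finset.sum_comm]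
  simp

/-- `x^a D_k`. -/
def md (a : Fin n → ZMod p) (k : Fin n) : W F p n := mon F p a • D F p k

theorem D_mon_eq_zero {a : Fin n → ZMod p} {k : Fin n} (ha : a k = 0) :
    D F p k (mon F p a) = 0 := by
  rw [D_mon, ha, map_zero, zero_smul]

theorem md_mem_SPrime {a : Fin n → ZMod p} {k : Fin n} (ha : a k = 0) :
    md F p a k ∈ SPrime F p n := by
  rw [mem_SPrime, md, div_smul_D, D_mon_eq_zero F p ha]

omit [Fact p.Prime] in
theorem lie_mem_S {E E' : W F p n} (hE : E ∈ SPrime F p n) (hE' : E' ∈ SPrime F p n) :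
    ⁅E, E'⁆ ∈ S F p n :=
  (mem_derivedSubalgebra_iff _ _).2 (Submodule.subset_span ⟨E, hE, E', hE', rfl⟩)

theorem exists_third (hn : 3 ≤ n) (k l : Fin n) : ∃ j, j ≠ k ∧ j ≠ l := by
  have : ∃ j, j ∉ ({k, l} : Finset (Fin n)) := by
    by_contra! h
    have h1 := Finset.card_le_card (fun j _ => h j : Finset.univ ⊆ ({k, l} : Finset (Fin n)))
    have h2 := Finset.card_le_two (a := k) (b := l)
    rw [Finset.card_univ, Fintype.card_fin] at h1
    omega
  simpa using this

/-- Only p - 1 needs splitting, as (p - 2) + 1; the part 1 differs from -1 because p ≠ 2. Adding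
`val`s means no carry, so the monomials multiply. -/
theorem exists_split_residue (hp : p ≠ 2) (c : ZMod p) :
    ∃ s t : ZMod p, s.val + t.val = c.val ∧ s ≠ -1 ∧ t ≠ -1 := by
  have h2 := (Fact.out : p.Prime).two_le
  by_cases h : c = -1
  · have h1 : (1 : ZMod p) ≠ -1 := fun h => by
      have : ((2 : ℕ) : ZMod p) = 0 := by
        rw [Nat.cast_two, ← one_add_one_eq_two]; nth_rewrite 2 [h]; ring
      rw [ZMod.natCast_eq_zero_iff] at this
      exact hp (((Nat.prime_dvd_prime_iff_eq Fact.out Nat.prime_two).1 this))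
    have hv : (1 : ZMod p).val ≤ (-1 : ZMod p).val := by
      rw [ZMod.val_one, Nat.one_le_iff_ne_zero, Ne, ZMod.val_eq_zero]
      simp
    refine ⟨-1 - 1, 1, ?_, ?_, h1⟩
    · rw [ZMod.val_sub hv, h, Nat.sub_add_cancel hv]
    · simp
  · exact ⟨c, 0, by simp, h, by simp⟩

/-- Each `D_{kl}(x^c)` is a bracket of two elements `x^a D_k` and `x^b D_l` of `S(n)`. -/
theorem exists_DD_mon_eq_lie (hp : p ≠ 2) (hn : 3 ≤ n) {k l : Fin n} (hkl : k ≠ l)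
    (c : Fin n → ZMod p) : ∃ a b : Fin n → ZMod p, a k = 0 ∧ (∃ j, j ≠ k ∧ a j ≠ -1) ∧
      b l = 0 ∧ (∃ j, j ≠ l ∧ b j ≠ -1) ∧ DD F p k l (mon F p c) = ⁅md F p a k, md F p b l⁆ := by
  obtain ⟨j, hjk, hjl⟩ := exists_third hn k l
  obtain ⟨s, t, hst, hs, ht⟩ := exists_split_residue p hp (c j)
  -- The variable x_k goes to b, and everything else but x_j to a. The exponent of the third
  -- variable x_j is shared so that neither factor has x_j^{p-1}: this puts both fields in S(n), not
  -- merely in S'(n).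
  let a : Fin n → ZMod p := fun i => if i = k then 0 else if i = j then s else c i
  let b : Fin n → ZMod p := fun i => if i = k then c k else if i = j then t else 0
  have ha : a k = 0 := by simp [a]
  have hb : b l = 0 := by simp [b, hkl.symm, hjl.symm]
  refine ⟨a, b, ha, ⟨j, hjk, by simpa [a, hjk] using hs⟩, hb, ⟨j, hjl, by simpa [b, hjk] using ht⟩,
    ?_⟩
  rw [md, md, lie_smul_D_smul_D F p (D_mon_eq_zero F p ha) (D_mon_eq_zero F p hb),
    mon_mul_mon F p (c := c)]
  intro i
  simp only [a, b]
  split_ifs with h1 h2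
  · simp [h1]
  · rw [h2, hst]
  · simp

theorem DD_mem_S (hp : p ≠ 2) (hn : 3 ≤ n) (k l : Fin n) (f : A F p n) :
    DD F p k l f ∈ S F p n := by
  rcases eq_or_ne k l with rfl | hkl
  · rw [DD_self]
    exact zero_mem _
  rw [← sum_cf_mon F p f, map_sum]
  refine sum_mem fun c _ => ?_
  rw [map_smul]
  obtain ⟨a, b, ha, -, hb, -, h⟩ := exists_DD_mon_eq_lie F p hp hn hkl c
  rw [h]
  exact (S F p n).smul_mem _ (lie_mem_S F p (md_mem_SPrime F p ha) (md_mem_SPrime F p hb))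

/-- `S(n)` is spanned by the `D_{kl}(x^c)`. -/
theorem mem_span_of_mem_S {E : W F p n} (hE : E ∈ S F p n) :
    E ∈ Submodule.span F {G | ∃ k l, k ≠ l ∧ ∃ c, DD F p k l (mon F p c) = G} := by
  refine Submodule.span_le.2 ?_ ((mem_derivedSubalgebra_iff _ _).1 hE)
  rintro _ ⟨E, hE, E', hE', rfl⟩
  rw [lie_eq_sum_DD F p hE hE']
  refine sum_mem fun i _ => sum_mem fun j _ => ?_
  rcases eq_or_ne i j with rfl | hij
  · rw [DD_self]
    exact zero_mem _
  rw [← sum_cf_mon F p (_ * _), map_sum]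
  refine sum_mem fun c _ => ?_
  rw [map_smul]
  exact Submodule.smul_mem _ _ (Submodule.subset_span ⟨i, j, hij, c, rfl⟩)

omit [Fact p.Prime] in
theorem S_le_SPrime : S F p n ≤ SPrime F p n := by
  intro E hE
  refine (Submodule.span_le (p := (SPrime F p n).toSubmodule)).2 ?_
    ((mem_derivedSubalgebra_iff _ _).1 hE)
  rintro _ ⟨E, hE, E', hE', rfl⟩
  exact (SPrime F p n).lie_mem hE hE'

theorem smul_md_sub_smul_md (b : Fin n → ZMod p) {k l : Fin n} (hkl : k ≠ l) :
    ι F p (b l + 1) • md F p (b + Pi.single k 1) k -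
        ι F p (b k + 1) • md F p (b + Pi.single l 1) l =
      DD F p l k (mon F p (b + Pi.single k 1 + Pi.single l 1)) := by
  have h1 : (b + Pi.single k 1 + Pi.single l 1 : Fin n → ZMod p) l = b l + 1 := by
    simp [hkl.symm]
  have h2 : (b + Pi.single k 1 + Pi.single l 1 : Fin n → ZMod p) k = b k + 1 := by
    simp [hkl]
  have h3 : b + Pi.single k 1 + Pi.single l 1 - Pi.single k 1 = b + Pi.single l 1 := by abel
  rw [DD_apply, D_mon, D_mon, h1, h2, h3, add_sub_cancel_right, md, md,
    smul_assoc _ (mon F p _) (D F p k), smul_assoc _ (mon F p _) (D F p l)]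

/-- Integrating x^a in a variable x_l with a_l ≠ p-1 exhibits (a_l + 1) x^a D_k as
D_{lk}(x^{a+ε_l}); the other term vanishes since a_k = 0. -/
theorem md_mem_S (hp : p ≠ 2) (hn : 3 ≤ n) {a : Fin n → ZMod p} {k : Fin n} (ha : a k = 0)
    (h : ∃ j, j ≠ k ∧ a j ≠ -1) : md F p a k ∈ S F p n := by
  obtain ⟨l, hlk, hl⟩ := h
  have h1 := smul_md_sub_smul_md F p (a - Pi.single k 1) hlk.symm
  have hl' : ι F p (a l + 1) ≠ 0 := by
    rw [Ne, ι_eq_zero]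
    exact fun h => hl (eq_neg_of_add_eq_zero_left h)
  simp only [Pi.sub_apply, Pi.single_eq_same, Pi.single_eq_of_ne hlk, sub_zero, ha, zero_sub,
    neg_add_cancel, map_zero, zero_smul, sub_add_cancel] at h1
  rw [sub_zero (ι F p (a l + 1) • md F p a k)] at h1
  rw [← inv_smul_smul₀ hl' (md F p a k), h1]
  exact (S F p n).smul_mem _ (DD_mem_S F p hp hn _ _ _)

theorem md_zero (k : Fin n) : md F p 0 k = D F p k := by
  rw [md, mon_zero, one_smul]

theorem D_mem_S (hp : p ≠ 2) (hn : 3 ≤ n) (k : Fin n) : D F p k ∈ S F p n := by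
  obtain ⟨j, hj, -⟩ := exists_third hn k k
  rw [← md_zero]
  exact md_mem_S F p hp hn rfl ⟨j, hj, by simp⟩

/-- `x_i D_i - x_j D_j`. -/
def hh (i j : Fin n) : W F p n := xD F p i - xD F p j

theorem hh_mem_S (hp : p ≠ 2) (hn : 3 ≤ n) (i j : Fin n) : hh F p i j ∈ S F p n := by
  rcases eq_or_ne i j with rfl | hij
  · rw [hh, sub_self (xD F p i)]
    exact zero_mem _
  have : hh F p i j = DD F p j i (x F p i * x F p j) := by
    simp [hh, xD, DD_apply, Derivation.leibniz, D_x, hij, hij.symm]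
  rw [this]
  exact DD_mem_S F p hp hn _ _ _

/-! ### Brackets in coordinates -/

omit [Fact p.Prime] in
theorem lie_D_apply_x (i k : Fin n) (E : W F p n) :
    ⁅D F p i, E⁆ (x F p k) = D F p i (E (x F p k)) := by
  rw [Derivation.commutator_apply, D_x]
  split_ifs <;> simp

theorem cf_md (a b : Fin n → ZMod p) (k l : Fin n) :
    cf F p b (md F p a k (x F p l)) = if a = b ∧ l = k then 1 else 0 := by
  simp only [md, Derivation.smul_apply, D_x, smul_eq_mul, mul_ite, mul_one, mul_zero]
  split_ifs with h1 h2 h2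
  · simp [cf_mon, h2.1]
  · rw [cf_mon, if_neg fun h => h2 ⟨h, h1⟩]
  · exact absurd h2.2 h1
  · simp

/-- Under x_iD_i the element x^a D_k has weight (a - ε_k)_i: a_i from the monomial, and -1 from D_k
when i = k. -/
theorem cf_lie_hh (i j : Fin n) (E : W F p n) (a : Fin n → ZMod p) (k : Fin n) :
    cf F p a (⁅hh F p i j, E⁆ (x F p k)) =
      ι F p ((a - Pi.single k 1 : Fin n → ZMod p) i - (a - Pi.single k 1 : Fin n → ZMod p) j) *
        cf F p a (E (x F p k)) := by
  have h1 : ∀ i : Fin n, cf F p a (⁅xD F p i, E⁆ (x F p k)) =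
      ι F p ((a - Pi.single k 1 : Fin n → ZMod p) i) * cf F p a (E (x F p k)) := by
    intro i
    rw [Derivation.commutator_apply]
    simp only [xD, Derivation.smul_apply, smul_eq_mul, D_x, map_sub, cf_x_mul_D]
    rcases eq_or_ne k i with rfl | hki
    · simp [sub_mul]
    · simp [hki, hki.symm]
  rw [hh, sub_lie (xD F p i) (xD F p j) E, Derivation.sub_apply, map_sub, h1, h1, map_sub, sub_mul]

omit [Fact p.Prime] in
theorem lie_hh_hh (i j k l : Fin n) : ⁅hh F p i j, hh F p k l⁆ = 0 := by
  have h : ∀ i k : Fin n, ⁅xD F p i, xD F p k⁆ = 0 := by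
    intro i k
    rcases eq_or_ne i k with rfl | hik
    · exact lie_self (xD F p i)
    · apply W_ext
      intro m
      simp only [xD, Derivation.commutator_apply, Derivation.smul_apply, D_x, smul_eq_mul,
        mul_ite, mul_one, mul_zero]
      split_ifs <;> simp_all [D_x]
  rw [hh, hh, sub_lie (xD F p i) (xD F p j) (xD F p k - xD F p l),
    lie_sub (xD F p i) (xD F p k) (xD F p l), lie_sub (xD F p j) (xD F p k) (xD F p l), h, h, h, h]
  exact sub_self (0 - 0 : W F p n)

end

end SpecialAlgebra

namespace SpecialAlgebra

noncomputable section

/-! ### Derivations in coordinates -/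

/-- Coordinates on a Lie algebra in which it looks like `W(n)`: `w a k` is the coefficient of
`m a k = x^a D_k`, and `h i j` stands for `x_i D_i - x_j D_j`. -/
structure Frame (F : Type*) [Field F] (p : ℕ) [Fact p.Prime] [CharP F p] (n : ℕ)
    (L : Type*) [LieRing L] [LieAlgebra F L] where
  /-- The elements `x^a D_k`. -/
  m : (Fin n → ZMod p) → Fin n → L
  /-- The elements `x_i D_i - x_j D_j`. -/
  h : Fin n → Fin n → L
  /-- The coefficient of `x^a D_k`. -/
  w : (Fin n → ZMod p) → Fin n → L →ₗ[F] F
  ext : ∀ {E E' : L}, (∀ a k, w a k E = w a k E') → E = E'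
  surj : ∀ c : (Fin n → ZMod p) → Fin n → F, ∃ E, ∀ a k, w a k E = c a k
  w_m : ∀ a b k l, w b l (m a k) = if a = b ∧ l = k then 1 else 0
  w_lie_d : ∀ i E a k, w a k ⁅m 0 i, E⁆ = ι F p (a i + 1) * w (a + Pi.single i 1) k E
  w_lie_h : ∀ i j E a k, w a k ⁅h i j, E⁆ =
    ι F p ((a - Pi.single k 1 : Fin n → ZMod p) i - (a - Pi.single k 1 : Fin n → ZMod p) j) *
      w a k E
  lie_h_h : ∀ i j k l, ⁅h i j, h k l⁆ = 0

namespace Frame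

variable {F : Type*} [Field F] {p : ℕ} [Fact p.Prime] [CharP F p] {n : ℕ}
  {L : Type*} [LieRing L] [LieAlgebra F L] (𝓕 : Frame F p n L)

include 𝓕

theorem lie_d_m (i : Fin n) (a : Fin n → ZMod p) (k : Fin n) :
    ⁅𝓕.m 0 i, 𝓕.m a k⁆ = ι F p (a i) • 𝓕.m (a - Pi.single i 1) k := by
  apply 𝓕.ext
  intro b l
  rw [𝓕.w_lie_d, map_smul, 𝓕.w_m, 𝓕.w_m, smul_eq_mul]
  by_cases h : a = b + Pi.single i 1
  · subst h
    simp
  · rw [if_neg fun h' => h h'.1, if_neg fun h' => h (by rw [← h'.1, sub_add_cancel]), mul_zero,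
      mul_zero]

theorem lie_h_m (i j : Fin n) (a : Fin n → ZMod p) (k : Fin n) :
    ⁅𝓕.h i j, 𝓕.m a k⁆ = ι F p ((a - Pi.single k 1 : Fin n → ZMod p) i -
      (a - Pi.single k 1 : Fin n → ZMod p) j) • 𝓕.m a k := by
  apply 𝓕.ext
  intro b l
  rw [𝓕.w_lie_h, map_smul, 𝓕.w_m, smul_eq_mul]
  split_ifs with h
  · rw [h.1, h.2]
  · simp

theorem lie_d_d (i j : Fin n) : ⁅𝓕.m 0 i, 𝓕.m 0 j⁆ = 0 := by
  rw [lie_d_m, Pi.zero_apply, map_zero, zero_smul]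

/-- An element commuting with all `D_i` has constant coefficients. -/
theorem w_eq_zero_of_lie_d {E : L} (h : ∀ i, ⁅𝓕.m 0 i, E⁆ = 0) {a : Fin n → ZMod p} (ha : a ≠ 0)
    (k : Fin n) : 𝓕.w a k E = 0 := by
  obtain ⟨i, hi⟩ := Function.ne_iff.1 ha
  have := 𝓕.w_lie_d i E (a - Pi.single i 1) k
  rw [h i, map_zero] at this
  simpa [ι_eq_zero, show a i ≠ 0 from hi] using this

/-- Commuting with the D_i leaves only constant coefficients, and each D_k has nonzero weight under
x_kD_k - x_iD_i for i ≠ k. -/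
theorem eq_zero_of_lie_eq_zero (hn : 2 ≤ n) {E : L} (hd : ∀ i, ⁅𝓕.m 0 i, E⁆ = 0)
    (hh : ∀ i j, ⁅𝓕.h i j, E⁆ = 0) : E = 0 := by
  apply 𝓕.ext
  intro a k
  rw [map_zero]
  rcases eq_or_ne a 0 with rfl | ha
  · have : Nontrivial (Fin n) := Fin.nontrivial_iff_two_le.2 hn
    obtain ⟨i, hi⟩ := exists_ne k
    have := 𝓕.w_lie_h i k E 0 k
    rw [hh, map_zero] at this
    simpa [hi] using this.symm
  · exact 𝓕.w_eq_zero_of_lie_d hd ha k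

/-! ### Cocycles with values in W(n) are inner -/

section Cocycle

variable {K : LieSubalgebra F L} (φ : K →ₗ[F] L)
  (hφ : ∀ s t : K, φ ⁅s, t⁆ = ⁅(s : L), φ t⁆ - ⁅(t : L), φ s⁆)
  (hd : ∀ i, 𝓕.m 0 i ∈ K) (hh : ∀ i j, 𝓕.h i j ∈ K)

include hφ hd hh

/-- A cocycle agrees on the `D_i` with an inner derivation. -/
theorem exists_lie_eq_on_d (hn : 2 ≤ n) : ∃ E : L, ∀ i, φ ⟨_, hd i⟩ = ⁅E, 𝓕.m 0 i⁆ := by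
  have hclosed : ∀ i j, ⁅𝓕.m 0 i, φ ⟨_, hd j⟩⁆ = ⁅𝓕.m 0 j, φ ⟨_, hd i⟩⁆ := by
    intro i j
    have h := hφ ⟨_, hd i⟩ ⟨_, hd j⟩
    have h0 : (⁅(⟨_, hd i⟩ : K), ⟨_, hd j⟩⁆ : K) = 0 := Subtype.ext (𝓕.lie_d_d i j)
    rw [h0, map_zero] at h
    exact (sub_eq_zero.1 h.symm)
  have hc : ∀ i j (a : Fin n → ZMod p) k,
      ι F p (a i + 1) * 𝓕.w (a + Pi.single i 1) k (φ ⟨_, hd j⟩) =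
      ι F p (a j + 1) * 𝓕.w (a + Pi.single j 1) k (φ ⟨_, hd i⟩) := by
    intro i j a k
    rw [← 𝓕.w_lie_d, ← 𝓕.w_lie_d, hclosed]
  -- These coefficients obstruct integration. Apply φ to [h_{ij}, D_i] = -D_i: the term [D_i,
  -- φ(h_{ij})] has no x_i^{p-1}, and closedness kills a_j times the coefficient, leaving only
  -- δ_{jk} - δ_{ik} as scalar.
  have hvan : ∀ i a k, a i = -1 → 𝓕.w a k (φ ⟨_, hd i⟩) = 0 := by
    intro i a k ha
    have key : ∀ j, j ≠ i →
        ι F p ((Pi.single k 1 : Fin n → ZMod p) j - (Pi.single k 1 : Fin n → ZMod p) i) *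
          𝓕.w a k (φ ⟨_, hd i⟩) = 0 := by
      intro j hj
      have h1 := hφ ⟨_, hh i j⟩ ⟨_, hd i⟩
      have h2 : (⁅(⟨_, hh i j⟩ : K), ⟨_, hd i⟩⁆ : K) = -⟨_, hd i⟩ := by
        apply Subtype.ext
        change ⁅𝓕.h i j, 𝓕.m 0 i⁆ = -𝓕.m 0 i
        rw [𝓕.lie_h_m]
        simp [hj]
      rw [h2, map_neg] at h1
      have h3 := congrArg (𝓕.w a k) h1
      rw [map_neg, map_sub, 𝓕.w_lie_h, 𝓕.w_lie_d, ha, neg_add_cancel, map_zero, zero_mul,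
        sub_zero] at h3
      have h4 := hc j i (a - Pi.single j 1) k
      simp only [Pi.sub_apply, Pi.single_eq_same, Pi.single_eq_of_ne hj.symm, sub_zero,
        sub_add_cancel, ha, neg_add_cancel, map_zero, zero_mul] at h4
      simp only [Pi.sub_apply, ha, map_sub, map_neg, map_one] at h3 ⊢
      linear_combination h4 - h3
    have : Nontrivial (Fin n) := Fin.nontrivial_iff_two_le.2 hn
    rcases eq_or_ne k i with rfl | hki
    · obtain ⟨j, hj⟩ := exists_ne k
      simpa [hj] using key j hj
    · simpa [hki.symm] using key k hki
  have hprim := fun k => exists_primitive F p (fun i a => -𝓕.w a k (φ ⟨_, hd i⟩))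
    (fun i j a => by simp only [mul_neg, hc i j a k]) (fun i a ha => by simp [hvan i a k ha])
  choose c hc' using hprim
  obtain ⟨E, hE⟩ := 𝓕.surj fun a k => c k a
  refine ⟨E, fun i => 𝓕.ext fun a k => ?_⟩
  rw [← lie_skew, map_neg, 𝓕.w_lie_d, hE, hc', neg_neg]

/-- A cocycle vanishing on the `D_i` agrees on the `x_i D_i - x_j D_j` with a bracket by an
element commuting with the `D_i`. -/
theorem exists_lie_eq_on_h (hn : 2 ≤ n) (h0 : ∀ i, φ ⟨_, hd i⟩ = 0) :
    ∃ v : L, (∀ i, ⁅v, 𝓕.m 0 i⁆ = 0) ∧ ∀ i j, φ ⟨_, hh i j⟩ = ⁅v, 𝓕.h i j⁆ := by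
  have hconst : ∀ i j k, ⁅𝓕.m 0 k, φ ⟨_, hh i j⟩⁆ = 0 := by
    intro i j k
    have h1 := hφ ⟨_, hh i j⟩ ⟨_, hd k⟩
    have h2 : (⁅(⟨_, hh i j⟩ : K), ⟨_, hd k⟩⁆ : K) = ι F p
        ((0 - Pi.single k 1 : Fin n → ZMod p) i - (0 - Pi.single k 1 : Fin n → ZMod p) j) •
          ⟨_, hd k⟩ := Subtype.ext (𝓕.lie_h_m i j 0 k)
    rw [h2, map_smul, h0, smul_zero, lie_zero, zero_sub, eq_comm, neg_eq_zero] at h1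
    exact h1
  have hcomm : ∀ i j k l r, ι F p ((0 - Pi.single r 1 : Fin n → ZMod p) i -
      (0 - Pi.single r 1 : Fin n → ZMod p) j) * 𝓕.w 0 r (φ ⟨_, hh k l⟩) =
      ι F p ((0 - Pi.single r 1 : Fin n → ZMod p) k -
      (0 - Pi.single r 1 : Fin n → ZMod p) l) * 𝓕.w 0 r (φ ⟨_, hh i j⟩) := by
    intro i j k l r
    have h1 := hφ ⟨_, hh i j⟩ ⟨_, hh k l⟩
    have h2 : (⁅(⟨_, hh i j⟩ : K), ⟨_, hh k l⟩⁆ : K) = 0 := Subtype.ext (𝓕.lie_h_h i j k l)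
    rw [h2, map_zero] at h1
    have h3 := congrArg (𝓕.w 0 r) (sub_eq_zero.1 h1.symm)
    rwa [𝓕.w_lie_h, 𝓕.w_lie_h] at h3
  have : Nontrivial (Fin n) := Fin.nontrivial_iff_two_le.2 hn
  -- The element h_{s(r),r} acts on D_r with weight 1, so its value determines the D_r-coefficient
  -- of v.
  choose s hs using fun r : Fin n => exists_ne r
  obtain ⟨v, hv⟩ := 𝓕.surj fun a r => if a = 0 then -𝓕.w 0 r (φ ⟨_, hh (s r) r⟩) else 0
  refine ⟨v, fun i => 𝓕.ext fun a k => ?_, fun i j => 𝓕.ext fun a k => ?_⟩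
  · rw [← lie_skew, map_neg, 𝓕.w_lie_d, hv, map_zero]
    split_ifs with h
    · have : a i + 1 = 0 := by simpa using congrFun h i
      rw [this, map_zero, zero_mul, neg_zero]
    · simp
  · rw [← lie_skew, map_neg, 𝓕.w_lie_h, hv]
    split_ifs with h
    · subst h
      have := hcomm i j (s k) k k
      rw [mul_neg, neg_neg, this]
      simp [hs k]
    · rw [mul_zero, neg_zero]
      exact 𝓕.w_eq_zero_of_lie_d (hconst i j) h k

/-- A cocycle vanishing on the `D_i` and the `x_i D_i - x_j D_j` vanishes on the elements
`x^a D_k` of `S(n)` with `a_k = 0`. -/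
theorem eq_zero_on_m (hp : p ≠ 2) (hn : 3 ≤ n) (h0 : ∀ i, φ ⟨_, hd i⟩ = 0)
    (h1 : ∀ i j, φ ⟨_, hh i j⟩ = 0)
    (hm : ∀ a k, a k = 0 → (∃ j, j ≠ k ∧ a j ≠ -1) → 𝓕.m a k ∈ K)
    (hlie : ∀ k r, k ≠ r → ∀ a : Fin n → ZMod p, a k = 0 → a r = -1 - 1 →
      (∀ j, j ≠ k → j ≠ r → a j = -1) →
      𝓕.m a k = ⁅𝓕.m (-Pi.single r 1) k, 𝓕.m (fun j => if j = k ∨ j = r then 0 else -1) r⁆)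
    (a : Fin n → ZMod p) (k : Fin n) (hak : a k = 0) (haj : ∃ j, j ≠ k ∧ a j ≠ -1) :
    φ ⟨_, hm a k hak haj⟩ = 0 := by
  induction hN : ∑ i, (a i).val using Nat.strong_induction_on generalizing a k with
  | _ N ih =>
    subst hN
    have hone : (1 : ZMod p) ≠ 0 := one_ne_zero
    have hvneg : (-1 : ZMod p).val + 1 = p := by
      have := ZMod.neg_val (1 : ZMod p)
      rw [if_neg hone, ZMod.val_one] at this
      have := (Fact.out : p.Prime).two_le
      omega
    have hp3 : 3 ≤ p := by
      have := (Fact.out : p.Prime).two_le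
      omega
    -- Bracketing with D_i lowers the degree, where φ vanishes by induction; if a_i ≠ 0, then a_i -
    -- 1 ≠ -1, so the lower monomial is still admissible.
    have hconst : ∀ i, ⁅𝓕.m 0 i, φ ⟨_, hm a k hak haj⟩⁆ = 0 := by
      intro i
      have h2 := hφ ⟨_, hd i⟩ ⟨_, hm a k hak haj⟩
      rw [h0, lie_zero, sub_zero] at h2
      rw [← h2]
      rcases eq_or_ne (a i) 0 with hi | hi
      · have h3 : (⁅(⟨_, hd i⟩ : K), ⟨_, hm a k hak haj⟩⁆ : K) = 0 := by
          apply Subtype.ext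
          change ⁅𝓕.m 0 i, 𝓕.m a k⁆ = 0
          rw [𝓕.lie_d_m, hi, map_zero, zero_smul]
        rw [h3, map_zero]
      · have hik : i ≠ k := fun h => hi (h ▸ hak)
        have hk' : (a - Pi.single i 1 : Fin n → ZMod p) k = 0 := by simp [hik.symm, hak]
        have hj' : ∃ j, j ≠ k ∧ (a - Pi.single i 1 : Fin n → ZMod p) j ≠ -1 :=
          ⟨i, hik, by simpa [sub_eq_iff_eq_add] using hi⟩
        have h3 : (⁅(⟨_, hd i⟩ : K), ⟨_, hm a k hak haj⟩⁆ : K) =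
            ι F p (a i) • ⟨_, hm _ k hk' hj'⟩ := Subtype.ext (𝓕.lie_d_m i a k)
        rw [h3, map_smul, ih _ ?_ _ k hk' hj' rfl, smul_zero]
        have hv : (1 : ZMod p).val ≤ (a i).val := by
          rw [ZMod.val_one, Nat.one_le_iff_ne_zero, Ne, ZMod.val_eq_zero]
          exact hi
        have hv' : (a i - 1).val < (a i).val := by
          rw [ZMod.val_sub hv]
          rw [ZMod.val_one] at hv ⊢
          omega
        refine Finset.sum_lt_sum (fun j _ => ?_) ⟨i, Finset.mem_univ _, by simpa using hv'⟩
        rcases eq_or_ne j i with rfl | hj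
        · simpa using hv'.le
        · simp [hj]
    apply 𝓕.ext
    intro b r
    rw [map_zero]
    rcases ne_or_eq b 0 with hb | rfl
    · exact 𝓕.w_eq_zero_of_lie_d hconst hb r
    by_contra hne
    -- A nonzero D_r-component forces x^a D_k and D_r to have equal weight under every h_{ij}.
    have hwt : ∀ i j, (a - Pi.single k 1 + Pi.single r 1 : Fin n → ZMod p) i =
        (a - Pi.single k 1 + Pi.single r 1 : Fin n → ZMod p) j := by
      intro i j
      have h2 := hφ ⟨_, hh i j⟩ ⟨_, hm a k hak haj⟩
      rw [h1, lie_zero, sub_zero] at h2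
      have h3 : (⁅(⟨_, hh i j⟩ : K), ⟨_, hm a k hak haj⟩⁆ : K) =
          ι F p ((a - Pi.single k 1 : Fin n → ZMod p) i -
            (a - Pi.single k 1 : Fin n → ZMod p) j) • ⟨_, hm a k hak haj⟩ :=
        Subtype.ext (𝓕.lie_h_m i j a k)
      rw [h3, map_smul] at h2
      have h4 := congrArg (𝓕.w 0 r) h2
      rw [map_smul, 𝓕.w_lie_h, smul_eq_mul] at h4
      have h5 := (ι F p).injective (mul_right_cancel₀ hne h4)
      simp only [Pi.sub_apply, Pi.add_apply, Pi.zero_apply] at h5 ⊢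
      linear_combination h5
    rcases eq_or_ne k r with rfl | hkr
    · have ha : a = 0 := by
        funext i
        have := hwt i k
        simpa [hak] using this
      subst ha
      exact hne (by rw [h0, map_zero])
    · have har : a r = -1 - 1 := by
        have := hwt r k
        simp only [Pi.add_apply, Pi.sub_apply, Pi.single_eq_same, Pi.single_eq_of_ne hkr,
          Pi.single_eq_of_ne hkr.symm, hak] at this
        linear_combination this
      have hother : ∀ j, j ≠ k → j ≠ r → a j = -1 := by
        intro j hjk hjr
        have := hwt j k
        simpa [hjk, hjr, hkr, hak] using this
      obtain ⟨t, htk, htr⟩ := exists_third hn k r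
      have hsum : ∑ i, (a i).val =
          ∑ i, ((fun j => if j = k ∨ j = r then 0 else -1 : Fin n → ZMod p) i).val +
            (-1 - 1 : ZMod p).val := by
        rw [← Finset.add_sum_erase _ _ (Finset.mem_univ r),
          ← Finset.add_sum_erase (a := r) _ (fun i => ZMod.val _) (Finset.mem_univ r), har]
        simp only [or_true, if_true, ZMod.val_zero, zero_add]
        rw [add_comm]
        congr 1
        refine Finset.sum_congr rfl fun i hi => ?_
        have hir := Finset.ne_of_mem_erase hi
        split_ifs with h
        · rw [h.resolve_right hir, hak]
        · push Not at h
          rw [hother i h.1 h.2]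
      have hv2 : (-1 - 1 : ZMod p).val + 2 = p := by
        have hle : (1 : ZMod p).val ≤ (-1 : ZMod p).val := by
          rw [ZMod.val_one]
          omega
        rw [ZMod.val_sub hle, ZMod.val_one]
        omega
      have hge : (-1 : ZMod p).val ≤
          ∑ i, ((fun j => if j = k ∨ j = r then 0 else -1 : Fin n → ZMod p) i).val := by
        have := Finset.single_le_sum
          (f := fun i => ((fun j => if j = k ∨ j = r then 0 else -1 : Fin n → ZMod p) i).val)
          (fun i _ => Nat.zero_le _) (Finset.mem_univ t)
        simpa [htk, htr] using this
      have hα : ∑ i, ((-Pi.single r 1 : Fin n → ZMod p) i).val = (-1 : ZMod p).val := by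
        rw [Finset.sum_eq_single r]
        · simp
        · intro j _ hj
          simp [hj]
        · simp
      have hα0 : (-Pi.single r 1 : Fin n → ZMod p) k = 0 := by simp [hkr]
      have hα1 : ∃ j, j ≠ k ∧ (-Pi.single r 1 : Fin n → ZMod p) j ≠ -1 :=
        ⟨t, htk, by simp [htr]⟩
      have hβ0 : (fun j => if j = k ∨ j = r then 0 else -1 : Fin n → ZMod p) r = 0 := by simp
      have hβ1 : ∃ j, j ≠ r ∧ (fun j => if j = k ∨ j = r then 0 else -1 : Fin n → ZMod p) j ≠ -1 :=
        ⟨k, hkr, by simp⟩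
      have hα2 := ih _ (by omega) _ k hα0 hα1 rfl
      have hβ2 := ih (∑ i, ((fun j => if j = k ∨ j = r then 0 else -1 : Fin n → ZMod p) i).val)
        (by omega) _ r hβ0 hβ1 rfl
      have hbr : (⟨_, hm a k hak haj⟩ : K) =
          ⁅(⟨_, hm _ k hα0 hα1⟩ : K), (⟨_, hm _ r hβ0 hβ1⟩ : K)⁆ :=
        Subtype.ext (hlie k r hkr a hak har hother)
      rw [hbr, hφ, hα2, hβ2, lie_zero, lie_zero, sub_zero, map_zero] at hne
      exact hne rfl

/-- Every cocycle on `S(n)` with values in `W(n)` is inner. -/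
theorem exists_eq_lie (hp : p ≠ 2) (hn : 3 ≤ n)
    (hm : ∀ a k, a k = 0 → (∃ j, j ≠ k ∧ a j ≠ -1) → 𝓕.m a k ∈ K)
    (hlie : ∀ k r, k ≠ r → ∀ a : Fin n → ZMod p, a k = 0 → a r = -1 - 1 →
      (∀ j, j ≠ k → j ≠ r → a j = -1) →
      𝓕.m a k = ⁅𝓕.m (-Pi.single r 1) k, 𝓕.m (fun j => if j = k ∨ j = r then 0 else -1) r⁆)
    (hK : ∀ E ∈ K, E ∈ Submodule.span F {G | ∃ a k b l, (a k = 0 ∧ ∃ j, j ≠ k ∧ a j ≠ -1) ∧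
      (b l = 0 ∧ ∃ j, j ≠ l ∧ b j ≠ -1) ∧ ⁅𝓕.m a k, 𝓕.m b l⁆ = G}) :
    ∃ E : L, ∀ s : K, φ s = ⁅E, (s : L)⁆ := by
  obtain ⟨E, hE⟩ := 𝓕.exists_lie_eq_on_d φ hφ hd hh (by omega)
  let ad (E : L) : K →ₗ[F] L := (LieAlgebra.ad F L E : L →ₗ[F] L) ∘ₗ K.toSubmodule.subtype
  have had : ∀ (E : L) (s : K), ad E s = ⁅E, (s : L)⁆ := fun _ _ => rfl
  have hsub : ∀ (ψ : K →ₗ[F] L) (E : L),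
      (∀ s t : K, ψ ⁅s, t⁆ = ⁅(s : L), ψ t⁆ - ⁅(t : L), ψ s⁆) →
      ∀ s t : K, (ψ - ad E) ⁅s, t⁆ = ⁅(s : L), (ψ - ad E) t⁆ - ⁅(t : L), (ψ - ad E) s⁆ := by
    intro ψ E hψ s t
    simp only [LinearMap.sub_apply, hψ, had, LieSubalgebra.coe_bracket, lie_sub, leibniz_lie E]
    rw [← lie_skew ⁅E, (s : L)⁆ (t : L)]
    abel
  have hφ1 := hsub φ E hφ
  have h01 : ∀ i, (φ - ad E) ⟨_, hd i⟩ = 0 := fun i => by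
    rw [LinearMap.sub_apply, hE, had, sub_self]
  obtain ⟨v, hv, hv'⟩ := 𝓕.exists_lie_eq_on_h _ hφ1 hd hh (by omega) h01
  have hφ2 := hsub _ v hφ1
  have h02 : ∀ i, (φ - ad E - ad v) ⟨_, hd i⟩ = 0 := fun i => by
    rw [LinearMap.sub_apply, h01, had, hv, sub_zero]
  have h12 : ∀ i j, (φ - ad E - ad v) ⟨_, hh i j⟩ = 0 := fun i j => by
    rw [LinearMap.sub_apply, hv', had, sub_self]
  have hzero := 𝓕.eq_zero_on_m _ hφ2 hd hh hp hn h02 h12 hm hlie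
  refine ⟨E + v, fun s => ?_⟩
  have hs : (s : L) ∈ Submodule.map K.toSubmodule.subtype (LinearMap.ker (φ - ad E - ad v)) := by
    refine Submodule.span_le.2 ?_ (hK s s.2)
    rintro _ ⟨a, k, b, l, ⟨ha, ha'⟩, ⟨hb, hb'⟩, rfl⟩
    refine ⟨⁅(⟨_, hm a k ha ha'⟩ : K), (⟨_, hm b l hb hb'⟩ : K)⁆, ?_, rfl⟩
    rw [SetLike.mem_coe, LinearMap.mem_ker, hφ2, hzero a k ha ha', hzero b l hb hb', lie_zero,
      lie_zero, sub_zero]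
  obtain ⟨t, ht, hts⟩ := hs
  obtain rfl : t = s := Subtype.ext hts
  replace ht : (φ - ad E - ad v) t = 0 := ht
  rw [LinearMap.sub_apply, LinearMap.sub_apply, had, had, sub_sub, sub_eq_zero, ← add_lie] at ht
  exact ht

end Cocycle

end Frame

end

end SpecialAlgebra

/-! ### Outer derivations from the normalizer -/

section Outer

variable {R : Type*} [CommRing R] {L : Type*} [LieRing L] [LieAlgebra R L]

theorem lieZ1_apply_lie {K : LieSubalgebra R L} (φ : LieZ1 R K K) (s t : K) :
    φ.1 ⁅s, t⁆ = ⁅s, φ.1 t⁆ - ⁅t, φ.1 s⁆ := by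
  have h : LieModule.Cohomology.d₁₂ R K K φ.1 = 0 := φ.2
  have h' : ⁅s, φ.1 t⁆ - ⁅t, φ.1 s⁆ - φ.1 ⁅s, t⁆ = 0 := by
    rw [← LieModule.Cohomology.d₁₂_apply_apply, h]
    rfl
  exact (sub_eq_zero.1 h').symm

theorem mk_eq_sum_adClass_iff {ι : Type*} [Fintype ι] {K : LieSubalgebra R L} {v : ι → L}
    (hv : ∀ i, v i ∈ K.normalizer) (φ : LieZ1 R K K) (c : ι → R) :
    ∑ i, c i • adClass K (v i) (hv i) = (Submodule.Quotient.mk φ : LieH1 R K K) ↔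
      ∃ m ∈ K, ∀ s : K, (φ.1 s : L) = ⁅∑ i, c i • v i + m, (s : L)⁆ := by
  have h1 : ∑ i, c i • adClass K (v i) (hv i) =
      (Submodule.Quotient.mk (∑ i, c i • adCocycle K (v i) (hv i)) : LieH1 R K K) := by
    rw [← Submodule.mkQ_apply, map_sum]
    rfl
  have h2 : ∀ s : K, (((∑ i, c i • adCocycle K (v i) (hv i) : LieZ1 R K K).1 s : K) : L) =
      ⁅∑ i, c i • v i, (s : L)⁆ := by
    intro s
    rw [AddSubmonoidClass.coe_finsetSum, LinearMap.sum_apply, AddSubmonoidClass.coe_finsetSum,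
      sum_lie]
    refine Finset.sum_congr rfl fun i _ => ?_
    rw [smul_lie]
    rfl
  rw [h1, eq_comm, Submodule.Quotient.eq]
  change (φ - ∑ i, c i • adCocycle K (v i) (hv i) : LieZ1 R K K).1 ∈ LieB1 R K K ↔ _
  constructor
  · rintro ⟨m, hm⟩
    -- The coboundary of m is s ↦ [s, m] = -[m, s], hence the sign.
    refine ⟨-m, neg_mem m.2, fun s => ?_⟩
    have h3 := congrArg (Subtype.val : K → L) (LinearMap.congr_fun hm s)
    have h4 : ⁅(s : L), (m : L)⁆ = (φ.1 s : L) - ⁅∑ i, c i • v i, (s : L)⁆ := by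
      rw [← h2 s]
      exact h3
    rw [add_lie, neg_lie, lie_skew, h4]
    abel
  · rintro ⟨m, hm, h⟩
    refine ⟨-⟨m, hm⟩, LinearMap.ext fun s => Subtype.ext ?_⟩
    change ⁅(s : L), -m⁆ = (φ.1 s : L) - _
    rw [h2, h, add_lie, lie_neg, lie_skew]
    abel

/-- If every derivation of `K` comes from the normalizer and `K` has trivial centralizer, then a
basis of the normalizer modulo `K` gives a basis of `H¹(K, K)`. -/
theorem exists_basis_lieH1 {F : Type*} [Field F] {L : Type*} [LieRing L] [LieAlgebra F L]
    {ι : Type*} [Fintype ι] {K : LieSubalgebra F L} {v : ι → L}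
    (hv : ∀ i, v i ∈ K.normalizer)
    (hinner : ∀ φ : LieZ1 F K K, ∃ E : L, ∀ s : K, (φ.1 s : L) = ⁅E, (s : L)⁆)
    (hspan : ∀ E ∈ K.normalizer, ∃ c : ι → F, E - ∑ i, c i • v i ∈ K)
    (hind : ∀ c : ι → F, ∑ i, c i • v i ∈ K → c = 0)
    (hcent : ∀ E : L, (∀ s ∈ K, ⁅E, s⁆ = 0) → E = 0) :
    ∃ b : Module.Basis ι F (LieH1 F K K), ∀ i, b i = adClass K (v i) (hv i) := by
  have hli : LinearIndependent F fun i => adClass K (v i) (hv i) := by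
    rw [Fintype.linearIndependent_iff]
    intro c hc
    rw [← Submodule.Quotient.mk_zero, mk_eq_sum_adClass_iff] at hc
    obtain ⟨m, hm, h⟩ := hc
    have h0 := hcent (∑ i, c i • v i + m) fun s hs => (h ⟨s, hs⟩).symm
    have := hind c (by rw [eq_neg_of_add_eq_zero_left h0]; exact neg_mem hm)
    exact fun i => congrFun this i
  refine ⟨Module.Basis.mk hli ?_, fun i => Module.Basis.mk_apply hli _ i⟩
  rintro y -
  obtain ⟨φ, rfl⟩ := Submodule.Quotient.mk_surjective _ y
  obtain ⟨E, hE⟩ := hinner φ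
  obtain ⟨c, hc⟩ := hspan E ((K.mem_normalizer_iff E).2 fun s hs => by
    have := hE ⟨s, hs⟩
    rw [← this]
    exact Subtype.prop _)
  have := (mk_eq_sum_adClass_iff hv φ c).2 ⟨_, hc, fun s => by rw [hE, add_sub_cancel]⟩
  rw [← this]
  exact sum_mem fun i _ => Submodule.smul_mem _ _ (Submodule.subset_span ⟨i, rfl⟩)

/-- A version of `exists_basis_lieH1` for a family `o` extended by one element `y`, with
independence detected by linear functionals. -/
theorem exists_basis_lieH1_of_functionals {F : Type*} [Field F] {L : Type*} [LieRing L]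
    [LieAlgebra F L] {ι : Type*} [Fintype ι] [DecidableEq ι] {K : LieSubalgebra F L} {o : ι → L}
    {y : L} (ho : ∀ i, o i ∈ K.normalizer) (hy : y ∈ K.normalizer)
    (hinner : ∀ φ : LieZ1 F K K, ∃ E : L, ∀ s : K, (φ.1 s : L) = ⁅E, (s : L)⁆)
    (hcent : ∀ E : L, (∀ s ∈ K, ⁅E, s⁆ = 0) → E = 0)
    (ε : L →ₗ[F] F) (hεK : ∀ s ∈ K, ε s = 0) (hεo : ∀ i, ε (o i) = 0) (hεy : ε y = 1)
    (w : ι → L →ₗ[F] F) (hwK : ∀ i, ∀ s ∈ K, w i s = 0)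
    (hwo : ∀ i j, w i (o j) = if i = j then 1 else 0)
    (hspan : ∀ E ∈ K.normalizer, E - ε E • y ∈ K.toSubmodule ⊔ Submodule.span F (Set.range o)) :
    ∃ b : Module.Basis (ι ⊕ Unit) F (LieH1 F K K),
      (∀ i, b (Sum.inl i) = adClass K (o i) (ho i)) ∧ b (Sum.inr ()) = adClass K y hy := by
  have hsum : ∀ c : ι ⊕ Unit → F, ∑ i, c i • Sum.elim o (fun _ => y) i =
      ∑ i, c (Sum.inl i) • o i + c (Sum.inr ()) • y := fun c => by
    simp [Fintype.sum_sum_type]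
  suffices h : ∃ b : Module.Basis (ι ⊕ Unit) F (LieH1 F K K), ∀ i,
      b i = adClass K (Sum.elim o (fun _ => y) i) (Sum.rec ho (fun _ => hy) i) from
    h.imp fun b hb => ⟨fun i => hb (Sum.inl i), hb (Sum.inr ())⟩
  refine exists_basis_lieH1 _ hinner (fun E hE => ?_) (fun c hc => ?_) hcent
  · obtain ⟨s, hs, t, ht, hst⟩ := Submodule.mem_sup.1 (hspan E hE)
    obtain ⟨c, rfl⟩ := (Submodule.mem_span_range_iff_exists_fun F).1 ht
    refine ⟨Sum.elim c fun _ => ε E, ?_⟩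
    rw [hsum, add_comm, ← sub_sub]
    simp only [Sum.elim_inl, Sum.elim_inr]
    rwa [← hst, add_sub_cancel_right]
  · rw [hsum] at hc
    have h0 : c (Sum.inr ()) = 0 := by
      have := hεK _ hc
      simpa [hεo, hεy] using this
    rw [h0, zero_smul, add_zero] at hc
    funext j
    rcases j with j | j
    · have := hwK j _ hc
      simpa [hwo] using this
    · exact h0

end Outer

namespace SpecialAlgebra

noncomputable section

/-! ### Divergence-free elements in coordinates -/

namespace Frame

variable {F : Type*} [Field F] {p : ℕ} [Fact p.Prime] [CharP F p] {n : ℕ}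
  {L : Type*} [LieRing L] [LieAlgebra F L] (𝓕 : Frame F p n L)

/-- The exponent of `x^{τ - (p-1)ε_i}`. -/
def top (p : ℕ) {n : ℕ} (i : Fin n) : Fin n → ZMod p := fun j => if j = i then 0 else -1

/-- Indexing by b = a - ε_k collects the terms that contribute to the coefficient of x^b in the
divergence. -/
theorem eq_sum_m (E : L) :
    E = ∑ b : Fin n → ZMod p, ∑ k, 𝓕.w (b + Pi.single k 1) k E • 𝓕.m (b + Pi.single k 1) k := by
  apply 𝓕.ext
  intro a l
  simp only [map_sum, map_smul, 𝓕.w_m, smul_eq_mul]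
  rw [Finset.sum_comm, Finset.sum_eq_single l, Finset.sum_eq_single (a - Pi.single l 1)]
  · simp
  · intro b _ hb
    rw [if_neg fun h => hb (eq_sub_of_add_eq h.1), mul_zero]
  · simp
  · intro k _ hk
    refine Finset.sum_eq_zero fun b _ => ?_
    rw [if_neg fun h => hk h.2.symm, mul_zero]
  · simp

/-- For each b the condition is one linear equation with coefficients b_k + 1. If some b_l + 1 ≠ 0,
its solutions are spanned by the two-term relations with l; if all vanish, the equation is empty and
the terms are the x^{τ-(p-1)ε_k}D_k. -/
theorem mem_of_div_eq_zero {T : Submodule F L}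
    (hT : ∀ (b : Fin n → ZMod p) k l, k ≠ l → ι F p (b l + 1) • 𝓕.m (b + Pi.single k 1) k -
      ι F p (b k + 1) • 𝓕.m (b + Pi.single l 1) l ∈ T)
    (htop : ∀ k, 𝓕.m (top p k) k ∈ T) {E : L}
    (hE : ∀ b : Fin n → ZMod p, ∑ k, ι F p (b k + 1) * 𝓕.w (b + Pi.single k 1) k E = 0) :
    E ∈ T := by
  rw [𝓕.eq_sum_m E]
  refine sum_mem fun b _ => ?_
  by_cases hb : ∀ k, b k = -1
  · refine sum_mem fun k _ => T.smul_mem _ ?_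
    have : b + Pi.single k 1 = top p k := by
      funext j
      by_cases hj : j = k
      · subst hj
        simp [top, hb]
      · simp [top, hb, hj]
    rw [this]
    exact htop k
  · push Not at hb
    obtain ⟨l, hl⟩ := hb
    have hl' : ι F p (b l + 1) ≠ 0 := by
      rw [Ne, ι_eq_zero]
      exact fun h => hl (eq_neg_of_add_eq_zero_left h)
    rw [← T.smul_mem_iff hl']
    have h0 : ι F p (b l + 1) • ∑ k, 𝓕.w (b + Pi.single k 1) k E • 𝓕.m (b + Pi.single k 1) k =
        ∑ k, 𝓕.w (b + Pi.single k 1) k E • (ι F p (b l + 1) • 𝓕.m (b + Pi.single k 1) k -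
          ι F p (b k + 1) • 𝓕.m (b + Pi.single l 1) l) := by
      have h1 : ∑ k, 𝓕.w (b + Pi.single k 1) k E • ι F p (b k + 1) •
          𝓕.m (b + Pi.single l 1) l = 0 := by
        simp only [smul_smul]
        rw [← Finset.sum_smul]
        simp only [mul_comm _ (ι F p _)]
        rw [hE, zero_smul]
      simp only [smul_sub, Finset.sum_sub_distrib]
      rw [h1, sub_zero, Finset.smul_sum]
      exact Finset.sum_congr rfl fun k _ => smul_comm _ _ _
    rw [h0]
    refine sum_mem fun k _ => T.smul_mem _ ?_
    rcases eq_or_ne k l with rfl | hkl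
    · rw [sub_self]
      exact zero_mem _
    · exact hT b k l hkl

end Frame

/-! ### Coordinates on W(n) and the normalizer of S(n) -/

variable (F : Type*) [Field F] (p : ℕ) {n : ℕ} [Fact p.Prime] [CharP F p]

/-- The coordinates on `W(n)`. -/
def frame : Frame F p n (W F p n) where
  m := md F p
  h := hh F p
  w a k :=
    { toFun := fun E => cf F p a (E (x F p k))
      map_add' := fun E E' => by rw [Derivation.add_apply, map_add]
      map_smul' := fun c E => by rw [Derivation.smul_apply, map_smul, RingHom.id_apply] }
  ext h := W_ext_cf F p h
  surj c := by
    refine ⟨∑ k, (∑ b, c b k • mon F p b) • D F p k, fun a k => ?_⟩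
    change cf F p a ((∑ k, (∑ b, c b k • mon F p b) • D F p k : W F p n) (x F p k)) = _
    rw [sum_W_apply]
    simp only [Derivation.smul_apply, D_x, smul_eq_mul, mul_ite, mul_one, mul_zero,
      Finset.sum_ite_eq, Finset.mem_univ, if_true]
    rw [cf_sum_mon]
  w_m a b k l := cf_md F p a b k l
  w_lie_d i E a k := by
    change cf F p a (⁅md F p 0 i, E⁆ (x F p k)) = _
    rw [md_zero, lie_D_apply_x, cf_D]
    rfl
  w_lie_h i j E a k := cf_lie_hh F p i j E a k
  lie_h_h := lie_hh_hh F p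

theorem frame_w (a : Fin n → ZMod p) (k : Fin n) (E : W F p n) :
    (frame F p).w a k E = cf F p a (E (x F p k)) := rfl

theorem outer_eq_md (i : Fin n) : outer F p i = md F p (Frame.top p i) i := by
  rw [outer, md, mon]
  congr 2
  funext j
  have hv : (-1 : ZMod p).val = p - 1 := by
    have := ZMod.neg_val (1 : ZMod p)
    rwa [if_neg one_ne_zero, ZMod.val_one] at this
  by_cases hj : j = i
  · subst hj
    simp [Frame.top]
  · simp [Frame.top, hj, hv]

/-- The two monomials multiply to x^{τ-(p-1)ε_k}, so the bracket is D_{kr} of it; only the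
D_r-derivative survives, with factor -(p-1) = 1. -/
theorem md_eq_lie {k r : Fin n} (hkr : k ≠ r) {a : Fin n → ZMod p} (hak : a k = 0)
    (har : a r = -1 - 1) (ha : ∀ j, j ≠ k → j ≠ r → a j = -1) :
    md F p a k =
      ⁅md F p (-Pi.single r 1) k, md F p (fun j => if j = k ∨ j = r then 0 else -1) r⁆ := by
  have hα : (-Pi.single r 1 : Fin n → ZMod p) k = 0 := by simp [hkr]
  have hβ : (fun j => if j = k ∨ j = r then 0 else -1 : Fin n → ZMod p) r = 0 := by simp
  have h1 : Frame.top p k - Pi.single r 1 = a := by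
    funext j
    by_cases hjk : j = k
    · subst hjk
      simp [Frame.top, hkr, hak]
    · by_cases hjr : j = r
      · subst hjr
        simp [Frame.top, hjk, har]
      · simp [Frame.top, hjk, hjr, ha]
  have h2 : Frame.top p k r = -1 := by simp [Frame.top, hkr.symm]
  have h3 : Frame.top p k k = 0 := by simp [Frame.top]
  rw [md, md, md, lie_smul_D_smul_D F p (D_mon_eq_zero F p hα) (D_mon_eq_zero F p hβ),
    mon_mul_mon F p (c := Frame.top p k), DD_apply, D_mon_eq_zero F p h3, D_mon, h1, h2, map_neg,
    map_one, neg_one_smul]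
  · apply W_ext
    intro j
    simp
  · intro j
    by_cases hjk : j = k
    · subst hjk
      simp [Frame.top, hkr]
    · by_cases hjr : j = r
      · subst hjr
        simp [Frame.top, hjk]
      · simp [Frame.top, hjk, hjr]

/-- Every derivation of `S(n)` is given by the bracket with an element of `W(n)`. -/
theorem exists_eq_lie_of_cocycle (hp : p ≠ 2) (hn : 3 ≤ n) (φ : LieZ1 F (S F p n) (S F p n)) :
    ∃ E : W F p n, ∀ s : S F p n, (φ.1 s : W F p n) = ⁅E, (s : W F p n)⁆ := by
  refine (frame F p).exists_eq_lie ((S F p n).toSubmodule.subtype ∘ₗ φ.1) (fun s t => ?_)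
    (fun i => md_mem_S F p hp hn rfl ?_) (hh_mem_S F p hp hn) hp hn
    (fun a k h h' => md_mem_S F p hp hn h h') (fun k r hkr a h1 h2 h3 => md_eq_lie F p hkr h1 h2 h3)
    (fun E hE => ?_)
  · exact congrArg (Subtype.val : S F p n → W F p n) (lieZ1_apply_lie φ s t)
  · obtain ⟨j, hj, -⟩ := exists_third hn i i
    exact ⟨j, hj, by simp⟩
  · refine Submodule.span_mono ?_ (mem_span_of_mem_S F p hE)
    rintro _ ⟨k, l, hkl, c, rfl⟩
    obtain ⟨a, b, ha, ha', hb, hb', h⟩ := exists_DD_mon_eq_lie F p hp hn hkl c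
    exact ⟨a, k, b, l, ⟨ha, ha'⟩, ⟨hb, hb'⟩, h.symm⟩

theorem cf_div (b : Fin n → ZMod p) (E : W F p n) : cf F p b (div F p E) =
    ∑ k, ι F p (b k + 1) * (frame F p).w (b + Pi.single k 1) k E := by
  rw [div_apply, map_sum]
  exact Finset.sum_congr rfl fun k _ => cf_D F p b k _

theorem SPrime_le (hp : p ≠ 2) (hn : 3 ≤ n) : (SPrime F p n).toSubmodule ≤
    (S F p n).toSubmodule ⊔ Submodule.span F (Set.range (outer F p)) := by
  intro E hE
  refine (frame F p).mem_of_div_eq_zero (fun b k l hkl => ?_) (fun k => ?_) (fun b => ?_)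
  · refine Submodule.mem_sup_left ?_
    have := DD_mem_S F p hp hn l k (mon F p (b + Pi.single k 1 + Pi.single l 1))
    rw [← smul_md_sub_smul_md F p b hkl] at this
    exact this
  · exact Submodule.mem_sup_right (Submodule.subset_span ⟨k, outer_eq_md F p k⟩)
  · rw [← cf_div, (mem_SPrime F p E).1 hE, map_zero]

omit [Fact p.Prime] in
theorem div_xD (i : Fin n) : div F p (xD F p i) = 1 := by
  rw [xD, div_smul_D, D_x, if_pos rfl]

theorem div_outer (i : Fin n) : div F p (outer F p i) = 0 := by
  rw [outer_eq_md]
  exact md_mem_SPrime F p (by simp [Frame.top])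

/-- Since [D_i, E] is divergence-free, D_i(div E) = 0 for all i, so div E is a constant, and
x_{i₀}D_{i₀} has divergence 1. -/
theorem sub_smul_xD_mem_SPrime (hp : p ≠ 2) (hn : 3 ≤ n) (i₀ : Fin n) {E : W F p n}
    (hE : E ∈ (S F p n).normalizer) :
    E - cf F p 0 (div F p E) • xD F p i₀ ∈ SPrime F p n := by
  have hconst : ∀ i, D F p i (div F p E) = 0 := by
    intro i
    have hD := S_le_SPrime F p (D_mem_S F p hp hn i)
    have h1 := S_le_SPrime F p (((S F p n).mem_normalizer_iff' E).1 hE _ (D_mem_S F p hp hn i))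
    rw [mem_SPrime] at hD
    rwa [mem_SPrime, div_lie, hD, map_zero, sub_zero] at h1
  rw [mem_SPrime]
  refine (LinearMap.map_sub _ E _).trans ?_
  rw [LinearMap.map_smul, div_xD, ← Algebra.algebraMap_eq_smul_one,
    ← eq_algebraMap_of_D_eq_zero F p hconst, sub_self]

/-- The D_i-coefficient of D_{kl}(f) is zero or ± a derivative of f in some x_m with m ≠ i, which
cannot contain x_m^{p-1}. -/
theorem cf_top_eq_zero {E : W F p n} (hE : E ∈ S F p n) (i : Fin n) :
    (frame F p).w (Frame.top p i) i E = 0 := by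
  have : E ∈ LinearMap.ker ((frame F p).w (Frame.top p i) i) := by
    refine Submodule.span_le.2 ?_ (mem_span_of_mem_S F p hE)
    rintro _ ⟨k, l, hkl, c, rfl⟩
    have h0 : ∀ k, k ≠ i → cf F p (Frame.top p i) (D F p k (mon F p c)) = 0 := by
      intro k hk
      rw [cf_D]
      simp [Frame.top, hk]
    change cf F p (Frame.top p i) (DD F p k l (mon F p c) (x F p i)) = 0
    rw [DD_apply, Derivation.sub_apply, Derivation.smul_apply, Derivation.smul_apply, D_x, D_x]
    by_cases hil : i = l
    · subst hil
      simp [hkl.symm, h0 k hkl]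
    · by_cases hik : i = k
      · subst hik
        simp [hil, h0 l (Ne.symm hil)]
      · simp [hil, hik]
  exact this

theorem cf_top_outer (i j : Fin n) :
    (frame F p).w (Frame.top p i) i (outer F p j) = if i = j then 1 else 0 := by
  rw [outer_eq_md, frame_w, cf_md]
  by_cases hij : i = j
  · subst hij
    simp
  · simp [hij]

theorem eq_zero_of_centralizes (hp : p ≠ 2) (hn : 3 ≤ n) {E : W F p n}
    (hE : ∀ s ∈ S F p n, ⁅E, s⁆ = 0) : E = 0 := by
  have h : ∀ s ∈ S F p n, ⁅s, E⁆ = 0 := fun s hs => by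
    rw [← lie_skew s E, hE s hs]
    exact neg_zero (G := W F p n)
  refine (frame F p).eq_zero_of_lie_eq_zero (by omega) (fun i => ?_)
    (fun i j => h _ (hh_mem_S F p hp hn i j))
  have : (frame F p).m 0 i = D F p i := md_zero F p i
  rw [this]
  exact h _ (D_mem_S F p hp hn i)

end

end SpecialAlgebra

theorem theorem4p7 (F : Type*) [Field F] (p : ℕ) [Fact p.Prime] [CharP F p] (hp : p ≠ 2)
    (n : ℕ) (hn : 3 ≤ n) :
    ∃ b : Module.Basis (Fin n ⊕ Unit) F
        (LieH1 F (SpecialAlgebra.S F p n) (SpecialAlgebra.S F p n)),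
      (∀ i : Fin n, b (Sum.inl i) =
        adClass (SpecialAlgebra.S F p n) (SpecialAlgebra.outer F p i)
          (SpecialAlgebra.outer_mem F p i)) ∧
      b (Sum.inr ()) =
        adClass (SpecialAlgebra.S F p n) (SpecialAlgebra.xD F p ⟨0, by omega⟩)
          (SpecialAlgebra.xD_mem F p ⟨0, by omega⟩) := by
  refine exists_basis_lieH1_of_functionals (SpecialAlgebra.outer_mem F p)
    (SpecialAlgebra.xD_mem F p _) (SpecialAlgebra.exists_eq_lie_of_cocycle F p hp hn)
    (fun _ hE => SpecialAlgebra.eq_zero_of_centralizes F p hp hn hE)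
    (SpecialAlgebra.cf F p 0 ∘ₗ SpecialAlgebra.div F p) (fun s hs => ?_) (fun i => ?_) ?_
    (fun i => (SpecialAlgebra.frame F p).w (SpecialAlgebra.Frame.top p i) i)
    (fun i s hs => SpecialAlgebra.cf_top_eq_zero F p hs i) (SpecialAlgebra.cf_top_outer F p)
    (fun E hE => SpecialAlgebra.SPrime_le F p hp hn
      (SpecialAlgebra.sub_smul_xD_mem_SPrime F p hp hn _ hE))
  · rw [LinearMap.comp_apply, (SpecialAlgebra.mem_SPrime F p s).1
      (SpecialAlgebra.S_le_SPrime F p hs), map_zero]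
  · rw [LinearMap.comp_apply, SpecialAlgebra.div_outer, map_zero]
  · rw [LinearMap.comp_apply, SpecialAlgebra.div_xD, ← SpecialAlgebra.mon_zero,
      SpecialAlgebra.cf_mon, if_pos rfl]
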